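/- Let $L$ be a countable set of labels and let $\mathcal{M}=(M,\tau,\ell)$ be a Markov chain: a finite set $M$ of states, a transition distribution $\tau(m)\in\mathcal{D}(M)$ for each $m\in M$ (where $\mathcal{D}(X)$ is the set of probability distributions on a finite set $X$), and a labelling $\ell\colon M\to L$. For $\lambda\in(0,1]$, let $\delta_\lambda$ be the $\lambda$-discounted bisimilarity pseudometric, i.e. the least fixed point of the operator $$\Psi_\lambda(d)(m,n)=\begin{cases}1&\text{if }\ell(m)\neq\ell(n),\\ \lambda\cdot\mathcal{K}(d)(\tau(m),\tau(n))&\text{otherwise,}\end{cases}$$ on the pseudometrics $d\colon M\times M\to[0,1]$ ordered pointwise, where $\mathcal{K}(d)(\mu,\nu)=\min_\omega\sum_{x,y\in M}d(x,y)\,\omega(x,y)$, with $\omega\in\mathcal{D}(M\times M)$ ranging over the couplings of $(\mu,\nu)$ (left marginal $\mu$, right marginal $\nu$). Let $L'\supseteq L$ be a countable set (possibly $L'=L$) and $b\in L'$ a label with $b\neq\ell(m)$ for all $m\in M$. Let $\mathcal{M}_\lambda=(M\uplus\{\bot\},\tau_\lambda,\ell_\lambda)$ be the Markov chain with labels in $L'$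 obtained by adding a sink $\bot$: $\tau_\lambda(m)=(1-\lambda)1_\bot+\lambda\,\tau(m)$ and $\ell_\lambda(m)=\ell(m)$ for $m\in M$, while $\tau_\lambda(\bot)=1_\bot$ and $\ell_\lambda(\bot)=b$ (here $1_\bot$ is the Dirac distribution at $\bot$). For a measurable set $A\subseteq (L')^\omega$ of infinite label sequences (measurable for the $\sigma$-algebra generated by the cylinder sets), let $\Pr_{\mathcal{M}_\lambda,m}(A)$ be the probability that the label sequence of a run of $\mathcal{M}_\lambda$ started in $m$ belongs to $A$. Then for every $\lambda\in(0,1]$, every measurable $A\subseteq (L')^\omega$ and all $m,n\in M$, $$\bigl|\Pr_{\mathcal{M}_\lambda,m}(A)-\Pr_{\mathcal{M}_\lambda,n}(A)\bigr|\le\delta_\lambda(m,n).$$ -/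

import Mathlib

open MeasureTheory ProbabilityTheory

/-- A labelled Markov chain with (finite) state space `S` and labels in `L`: a transition
distribution for every state, and a labelling function. The finitely supported distributions
`𝒟(S)` on the finite set `S` are the points of `stdSimplex ℝ S`. -/
structure MarkovChain (S : Type*) [Fintype S] (L : Type*) where
  trans : S → stdSimplex ℝ S
  label : S → L

/-! ### Couplings and the Kantorovich pseudometric -/

section Kantorovich

variable {X : Type*} [Fintype X]

/-- The couplings of `(μ, ν)`: distributions on `X × X` with left marginal `μ` and right
marginal `ν`. -/
def couplings (μ ν : stdSimplex ℝ X) : Set (stdSimplex ℝ (X × X)) :=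
  {ω | (∀ x, ∑ y, ω (x, y) = μ x) ∧ (∀ y, ∑ x, ω (x, y) = ν y)}

/-- The transportation cost of `ω` with respect to `d`. -/
def transportCost (d : X → X → ℝ) (ω : stdSimplex ℝ (X × X)) : ℝ :=
  ∑ x, ∑ y, d x y * ω (x, y)

/-- The Kantorovich distance. The infimum is attained, see `kantorovich_isLeast`. -/
noncomputable def kantorovich (d : X → X → ℝ) (μ ν : stdSimplex ℝ X) : ℝ :=
  sInf (transportCost d '' couplings μ ν)

theorem couplings_nonempty (μ ν : stdSimplex ℝ X) : (couplings μ ν).Nonempty := by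
  have h1 : ∑ x, μ x = 1 := μ.2.2
  have h2 : ∑ x, ν x = 1 := ν.2.2
  refine ⟨⟨fun p => μ p.1 * ν p.2, fun p => mul_nonneg (μ.2.1 _) (ν.2.1 _), ?_⟩, ?_, ?_⟩
  · rw [Fintype.sum_prod_type]
    simp [← Finset.mul_sum, h1, h2]
  · intro x
    change ∑ y, μ x * ν y = μ x
    rw [← Finset.mul_sum, h2, mul_one]
  · intro y
    change ∑ x, μ x * ν y = ν y
    rw [← Finset.sum_mul, h1, one_mul]

theorem continuous_transportCost (d : X → X → ℝ) : Continuous (transportCost d) := by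
  have h (p : X × X) : Continuous fun ω : stdSimplex ℝ (X × X) => ω p :=
    (continuous_apply p).comp continuous_subtype_val
  exact continuous_finsetSum _ fun x _ => continuous_finsetSum _ fun y _ =>
    continuous_const.mul (h (x, y))

theorem isCompact_couplings (μ ν : stdSimplex ℝ X) : IsCompact (couplings μ ν) := by
  have h (p : X × X) : Continuous fun ω : stdSimplex ℝ (X × X) => ω p :=
    (continuous_apply p).comp continuous_subtype_val
  have : CompactSpace (stdSimplex ℝ (X × X)) :=
    isCompact_iff_compactSpace.mp (isCompact_stdSimplex ℝ _)
  apply IsClosed.isCompact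
  have he : couplings μ ν = (⋂ x, {ω : stdSimplex ℝ (X × X) | ∑ y, ω (x, y) = μ x}) ∩
      ⋂ y, {ω : stdSimplex ℝ (X × X) | ∑ x, ω (x, y) = ν y} := by
    ext ω; simp [couplings]
  rw [he]
  refine (isClosed_iInter fun x => ?_).inter (isClosed_iInter fun y => ?_)
  · exact isClosed_eq (continuous_finsetSum _ fun y _ => h (x, y)) continuous_const
  · exact isClosed_eq (continuous_finsetSum _ fun x _ => h (x, y)) continuous_const

theorem kantorovich_isLeast (d : X → X → ℝ) (μ ν : stdSimplex ℝ X) :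
    IsLeast (transportCost d '' couplings μ ν) (kantorovich d μ ν) :=
  ((isCompact_couplings μ ν).image (continuous_transportCost d)).isLeast_sInf
    ((couplings_nonempty μ ν).image _)

theorem kantorovich_le {d : X → X → ℝ} {μ ν : stdSimplex ℝ X} {ω : stdSimplex ℝ (X × X)}
    (h : ω ∈ couplings μ ν) : kantorovich d μ ν ≤ transportCost d ω :=
  (kantorovich_isLeast d μ ν).2 ⟨ω, h, rfl⟩

theorem exists_kantorovich_eq (d : X → X → ℝ) (μ ν : stdSimplex ℝ X) :
    ∃ ω ∈ couplings μ ν, transportCost d ω = kantorovich d μ ν :=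
  (kantorovich_isLeast d μ ν).1

theorem kantorovich_mono {d d' : X → X → ℝ} (h : ∀ x y, d x y ≤ d' x y) (μ ν : stdSimplex ℝ X) :
    kantorovich d μ ν ≤ kantorovich d' μ ν := by
  obtain ⟨ω, hω, he⟩ := exists_kantorovich_eq d' μ ν
  rw [← he]
  refine (kantorovich_le hω).trans ?_
  exact Finset.sum_le_sum fun x _ => Finset.sum_le_sum fun y _ =>
    mul_le_mul_of_nonneg_right (h x y) (ω.2.1 _)

end Kantorovich

/-! ### One-bounded pseudometrics -/

/-- A `1`-bounded pseudometric on `X`. -/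
@[ext] structure OneBddPseudometric (X : Type*) where
  toFun : X → X → ℝ
  nonneg : ∀ x y, 0 ≤ toFun x y
  le_one : ∀ x y, toFun x y ≤ 1
  self : ∀ x, toFun x x = 0
  symm : ∀ x y, toFun x y = toFun y x
  triangle : ∀ x y z, toFun x z ≤ toFun x y + toFun y z

namespace OneBddPseudometric

variable {X : Type*}

/-- The pointwise order. -/
instance : PartialOrder (OneBddPseudometric X) :=
  PartialOrder.lift toFun fun _ _ h => OneBddPseudometric.ext h

theorem le_iff {d d' : OneBddPseudometric X} :
    d ≤ d' ↔ ∀ x y, d.toFun x y ≤ d'.toFun x y := Iff.rfl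

/-- Suprema of `1`-bounded pseudometrics are computed pointwise. -/
noncomputable instance : SupSet (OneBddPseudometric X) where
  sSup D :=
    { toFun := fun x y => ⨆ d : D, d.1.toFun x y
      nonneg := fun x y => Real.iSup_nonneg fun d => d.1.nonneg x y
      le_one := fun x y => Real.iSup_le (fun d => d.1.le_one x y) zero_le_one
      self := fun x => by simp [OneBddPseudometric.self]
      symm := fun x y => by simp only [OneBddPseudometric.symm _ x y]
      triangle := fun x y z => by
        have hb (x y : X) : BddAbove (Set.range fun d : D => d.1.toFun x y) :=
          ⟨1, by rintro _ ⟨d, rfl⟩; exact d.1.le_one x y⟩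
        refine Real.iSup_le (fun d => (d.1.triangle x y z).trans ?_)
          (add_nonneg (Real.iSup_nonneg fun d => d.1.nonneg x y)
            (Real.iSup_nonneg fun d => d.1.nonneg y z))
        exact add_le_add (le_ciSup (hb x y) d) (le_ciSup (hb y z) d) }

theorem isLUB_sSup (D : Set (OneBddPseudometric X)) : IsLUB D (sSup D) := by
  constructor
  · intro d hd x y
    exact le_ciSup (f := fun d : D => d.1.toFun x y)
      ⟨1, by rintro _ ⟨d, rfl⟩; exact d.1.le_one x y⟩ ⟨d, hd⟩
  · intro d hd x y
    exact Real.iSup_le (fun e => hd e.2 x y) (d.nonneg x y)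

/-- The complete lattice of `1`-bounded pseudometrics, ordered pointwise. -/
noncomputable instance : CompleteLattice (OneBddPseudometric X) :=
  completeLatticeOfSup _ isLUB_sSup

variable [Fintype X] (d : OneBddPseudometric X)

theorem kantorovich_nonneg (μ ν : stdSimplex ℝ X) : 0 ≤ kantorovich d.toFun μ ν := by
  obtain ⟨ω, -, he⟩ := exists_kantorovich_eq d.toFun μ ν
  rw [← he]
  exact Finset.sum_nonneg fun x _ => Finset.sum_nonneg fun y _ =>
    mul_nonneg (d.nonneg x y) (ω.2.1 _)

theorem kantorovich_le_one (μ ν : stdSimplex ℝ X) : kantorovich d.toFun μ ν ≤ 1 := by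
  obtain ⟨ω, -, he⟩ := exists_kantorovich_eq d.toFun μ ν
  have h1 : ∑ p, ω p = 1 := ω.2.2
  rw [Fintype.sum_prod_type] at h1
  rw [← he, ← h1]
  exact Finset.sum_le_sum fun x _ => Finset.sum_le_sum fun y _ =>
    mul_le_of_le_one_left (ω.2.1 _) (d.le_one x y)

theorem kantorovich_self (μ : stdSimplex ℝ X) : kantorovich d.toFun μ μ = 0 := by
  classical
  refine le_antisymm ?_ (d.kantorovich_nonneg μ μ)
  have h1 : ∑ x, μ x = 1 := μ.2.2
  let ω : stdSimplex ℝ (X × X) := ⟨fun p => if p.1 = p.2 then μ p.1 else 0,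
    fun p => by dsimp only; split_ifs; exacts [μ.2.1 _, le_rfl], by
      rw [Fintype.sum_prod_type]; simp [h1]⟩
  have hω : ∀ x y, ω (x, y) = if x = y then μ x else 0 := fun _ _ => rfl
  have hc : ω ∈ couplings μ μ := ⟨fun x => by simp [hω], fun y => by simp [hω]⟩
  refine (kantorovich_le hc).trans (le_of_eq ?_)
  simp [transportCost, hω, d.self]

theorem kantorovich_comm_le (μ ν : stdSimplex ℝ X) :
    kantorovich d.toFun μ ν ≤ kantorovich d.toFun ν μ := by
  obtain ⟨ω, ⟨h1, h2⟩, he⟩ := exists_kantorovich_eq d.toFun ν μ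
  have hs : ∑ p, ω p = 1 := ω.2.2
  let ω' : stdSimplex ℝ (X × X) := ⟨fun p => ω (p.2, p.1), fun p => ω.2.1 _, by
    rw [Fintype.sum_prod_type, Finset.sum_comm, ← Fintype.sum_prod_type']; exact hs⟩
  have hc : ω' ∈ couplings μ ν := ⟨h2, h1⟩
  rw [← he]
  refine (kantorovich_le hc).trans (le_of_eq ?_)
  unfold transportCost
  rw [Finset.sum_comm]
  refine Finset.sum_congr rfl fun x _ => Finset.sum_congr rfl fun y _ => ?_
  rw [d.symm]; rfl

theorem kantorovich_triangle (μ ν ρ : stdSimplex ℝ X) :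
    kantorovich d.toFun μ ρ ≤ kantorovich d.toFun μ ν + kantorovich d.toFun ν ρ := by
  obtain ⟨α, ⟨a1, a2⟩, ha⟩ := exists_kantorovich_eq d.toFun μ ν
  obtain ⟨β, ⟨b1, b2⟩, hb⟩ := exists_kantorovich_eq d.toFun ν ρ
  have nα (x y : X) : 0 ≤ α (x, y) := α.2.1 _
  have nβ (x y : X) : 0 ≤ β (x, y) := β.2.1 _
  have nν (y : X) : 0 ≤ ν y := ν.2.1 _
  have zα (x y : X) (h : ν y = 0) : α (x, y) = 0 := by
    rw [← a2 y, Finset.sum_eq_zero_iff_of_nonneg fun _ _ => nα _ _] at h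
    exact h x (Finset.mem_univ x)
  have zβ (y z : X) (h : ν y = 0) : β (y, z) = 0 := by
    rw [← b1 y, Finset.sum_eq_zero_iff_of_nonneg fun _ _ => nβ _ _] at h
    exact h z (Finset.mem_univ z)
  let g (x y z : X) : ℝ := α (x, y) * β (y, z) / ν y
  have g0 (x y z : X) : 0 ≤ g x y z := div_nonneg (mul_nonneg (nα _ _) (nβ _ _)) (nν y)
  have gα (x y : X) : ∑ z, g x y z = α (x, y) := by
    simp only [g]
    rw [← Finset.sum_div, ← Finset.mul_sum, b1]
    by_cases h : ν y = 0
    · simp [h, zα x y h]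
    · field_simp
  have gβ (y z : X) : ∑ x, g x y z = β (y, z) := by
    simp only [g]
    rw [← Finset.sum_div, ← Finset.sum_mul, a2]
    by_cases h : ν y = 0
    · simp [h, zβ y z h]
    · field_simp
  have m1 (x : X) : ∑ z, ∑ y, g x y z = μ x := by
    rw [Finset.sum_comm]; simp only [gα]; exact a1 x
  have m2 (z : X) : ∑ x, ∑ y, g x y z = ρ z := by
    rw [Finset.sum_comm]; simp only [gβ]; exact b2 z
  have hμ : ∑ x, μ x = 1 := μ.2.2
  let ω : stdSimplex ℝ (X × X) := ⟨fun p => ∑ y, g p.1 y p.2,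
    fun p => Finset.sum_nonneg fun y _ => g0 _ _ _, by
      rw [Fintype.sum_prod_type]; simp only [m1]; exact hμ⟩
  have hc : ω ∈ couplings μ ρ := ⟨m1, m2⟩
  refine (kantorovich_le hc).trans ?_
  rw [← ha, ← hb]
  calc transportCost d.toFun ω = ∑ x, ∑ z, ∑ y, d.toFun x z * g x y z := by
        refine Finset.sum_congr rfl fun x _ => Finset.sum_congr rfl fun z _ => ?_
        rw [← Finset.mul_sum]; rfl
    _ ≤ ∑ x, ∑ z, ∑ y, (d.toFun x y * g x y z + d.toFun y z * g x y z) := by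
        refine Finset.sum_le_sum fun x _ => Finset.sum_le_sum fun z _ =>
          Finset.sum_le_sum fun y _ => ?_
        rw [← add_mul]
        exact mul_le_mul_of_nonneg_right (d.triangle x y z) (g0 x y z)
    _ = transportCost d.toFun α + transportCost d.toFun β := by
        simp only [Finset.sum_add_distrib]
        congr 1
        · refine Finset.sum_congr rfl fun x _ => ?_
          rw [Finset.sum_comm]
          simp only [← Finset.mul_sum, gα]
        · rw [Finset.sum_comm]
          have (z : X) : ∑ x, ∑ y, d.toFun y z * g x y z = ∑ y, d.toFun y z * β (y, z) := by
            rw [Finset.sum_comm]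
            simp only [← Finset.mul_sum, gβ]
          simp only [this]
          rw [Finset.sum_comm]
          rfl

end OneBddPseudometric

/-! ### The bisimilarity distance and the probability of a set of label sequences -/

namespace MarkovChain

variable {S : Type*} [Fintype S] {L : Type*} (C : MarkovChain S L)

open Classical in
/-- The functional `Ψ_λ` on `1`-bounded pseudometrics, as a monotone map. -/
noncomputable def bisimOperator (lam : ℝ) (hlam : lam ∈ Set.Ioc (0 : ℝ) 1) :
    OneBddPseudometric S →o OneBddPseudometric S where
  toFun d :=
    { toFun := fun m n =>
        if C.label m ≠ C.label n then 1
        else lam * kantorovich d.toFun (C.trans m) (C.trans n)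
      nonneg := fun m n => by
        have := mul_nonneg hlam.1.le (d.kantorovich_nonneg (C.trans m) (C.trans n))
        split_ifs <;> first | exact zero_le_one | exact this
      le_one := fun m n => by
        have := mul_le_one₀ hlam.2 (d.kantorovich_nonneg (C.trans m) (C.trans n))
          (d.kantorovich_le_one (C.trans m) (C.trans n))
        split_ifs <;> first | exact le_rfl | exact this
      self := fun m => by simp [d.kantorovich_self]
      symm := fun m n => by
        simp only [ne_comm (a := C.label m),
          le_antisymm (d.kantorovich_comm_le (C.trans m) (C.trans n))
            (d.kantorovich_comm_le (C.trans n) (C.trans m))]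
      triangle := fun m n k => by
        have t := mul_le_mul_of_nonneg_left
          (d.kantorovich_triangle (C.trans m) (C.trans n) (C.trans k)) hlam.1.le
        have h1 := mul_nonneg hlam.1.le (d.kantorovich_nonneg (C.trans m) (C.trans n))
        have h2 := mul_nonneg hlam.1.le (d.kantorovich_nonneg (C.trans n) (C.trans k))
        have h3 := mul_le_one₀ hlam.2 (d.kantorovich_nonneg (C.trans m) (C.trans k))
          (d.kantorovich_le_one (C.trans m) (C.trans k))
        split_ifs <;> first | linarith | (exfalso; simp_all) }
  monotone' d d' h := fun m n => by
    have := mul_le_mul_of_nonneg_left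
      (kantorovich_mono h (C.trans m) (C.trans n)) hlam.1.le
    change (if _ then _ else _) ≤ (if _ then _ else _)
    split_ifs <;> first | exact le_rfl | exact this

/-- The `λ`-discounted bisimilarity distance: the least fixed point of `Ψ_λ` in the complete
lattice of `1`-bounded pseudometrics. -/
noncomputable def bisimDist (lam : ℝ) (hlam : lam ∈ Set.Ioc (0 : ℝ) 1) (m n : S) : ℝ :=
  (OrderHom.lfp (C.bisimOperator lam hlam)).toFun m n

/-- The one-step transition kernel. -/
noncomputable def stepKernel [MeasurableSpace S] [DiscreteMeasurableSpace S] : Kernel S S where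
  toFun s := ∑ x, ENNReal.ofReal (C.trans s x) • Measure.dirac x
  measurable' := .of_discrete

instance [MeasurableSpace S] [DiscreteMeasurableSpace S] : IsMarkovKernel C.stepKernel where
  isProbabilityMeasure s := by
    have h : ∑ x, C.trans s x = 1 := (C.trans s).2.2
    constructor
    change (∑ x, ENNReal.ofReal (C.trans s x) • Measure.dirac x : Measure S) Set.univ = 1
    simp only [Measure.coe_finsetSum, Finset.sum_apply, Measure.smul_apply,
      measure_univ, smul_eq_mul, mul_one]
    rw [← ENNReal.ofReal_sum_of_nonneg fun x _ => stdSimplex.zero_le (C.trans s) x, h, ENNReal.ofReal_one]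

/-- The law, on infinite state sequences, of the run of the chain started in `m`: the first state
is `m`, and given the first `i + 1` states the next one is distributed according to the
transition distribution of the last of them. -/
noncomputable def runMeasure [MeasurableSpace S] [DiscreteMeasurableSpace S] (m : S) :
    Measure (ℕ → S) :=
  Kernel.trajMeasure (X := fun _ => S) (Measure.dirac m) fun i =>
    C.stepKernel.comap (fun w : (Finset.Iic i → S) => w ⟨i, Finset.mem_Iic.2 le_rfl⟩)
      (measurable_pi_apply _)

/-- The probability that the label sequence of a run started in `m` belongs to `A`. -/
noncomputable def prob (m : S) (A : Set (ℕ → L)) : ℝ :=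
  letI : MeasurableSpace S := ⊤
  (C.runMeasure m).real {w | (fun i => C.label (w i)) ∈ A}

/-- The chain `C` extended by a sink `none`, to which every state of `C` moves with probability
`1 - λ`; the labels are regarded as elements of a label set `L'` via `ι`, and the sink is
labelled by `b`. -/
noncomputable def withSink (lam : ℝ) (hlam : lam ∈ Set.Ioc (0 : ℝ) 1) {L' : Type*} (ι : L ↪ L')
    (b : L') : MarkovChain (Option S) L' where
  trans
    | none => ⟨fun x => x.elim 1 (fun _ => 0),
        by rintro (_ | _) <;> simp, by simp [Fintype.sum_option]⟩
    | some m => ⟨fun x => x.elim (1 - lam) (fun u => lam * C.trans m u),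
        by
          rintro (_ | u)
          · exact sub_nonneg.2 hlam.2
          · exact mul_nonneg hlam.1.le ((C.trans m).2.1 u),
        by
          have h : ∑ x, C.trans m x = 1 := (C.trans m).2.2
          simp [Fintype.sum_option, ← Finset.mul_sum, h]⟩
  label x := x.elim b (fun m => ι (C.label m))

end MarkovChain

/-!
For an event that depends only on the first `k` labels, the bound follows by induction on `k`. An
event depending on no label has probability `0` or `1` from every state. For the step, if the labels
of `m` and `n` differ then the distance is `1` and there is nothing to show. If they agree, both runs
emit the same first label, and the Markov property (`MarkovChain.prob_eq_sum`) writes the two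
probabilities as averages over the successors of the probability `f` of the shifted event. The sink
is reached with the same probability `1 - λ` from both states, so its contribution cancels and
`λ (∑ x, τ(m)(x) f(x) - ∑ x, τ(n)(x) f(x))` remains. By the induction hypothesis `f` is
nonexpansive for `δ_λ`, so `abs_sum_sub_sum_le_kantorovich` bounds this by
`λ 𝒦(δ_λ)(τ(m), τ(n))`, which is `δ_λ(m, n)` by the fixed point equation.

This is `MarkovChain.abs_prob_withSink_sub_le_of_dependsOn`. Cylinder events form a ring that
generates the `σ`-algebra, so they approximate every measurable event with respect to the sum of the
two label laws, and the bound extends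
(`MarkovChain.abs_prob_sub_le_of_measurableCylinders`). Running the one-step argument on all
measurable events at once would only show that the supremum `D` of the differences satisfies
`D ≤ Ψ_λ(D)`, which bounds it by the greatest fixed point; for `λ = 1` that may exceed `δ_λ`.

The Markov property for `runMeasure`, which is built by the Ionescu-Tulcea construction, holds
because the law of a run is determined by the probabilities of its finite prefixes
(`measure_ext_initialCylinder`), and these are products of transition probabilities.
-/

/-! ### Sequences and initial cylinders -/

/-- The sequence `a, w 0, w 1, …`. -/
def seqCons {α : Type*} (a : α) (w : ℕ → α) : ℕ → α
  | 0 => a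
  | i + 1 => w i

theorem comp_seqCons {α β : Type*} (f : α → β) (a : α) (w : ℕ → α) :
    (fun i => f (seqCons a w i)) = seqCons (f a) fun i => f (w i) := by
  ext (_ | i) <;> rfl

theorem measurable_seqCons {α : Type*} [MeasurableSpace α] (a : α) :
    Measurable (seqCons a : (ℕ → α) → ℕ → α) := by
  refine measurable_pi_lambda _ fun i => ?_
  cases i with
  | zero => exact measurable_const
  | succ i => exact measurable_pi_apply i

/-- The sequences that agree with `s` up to and including time `k`. -/
def initialCylinder {α : Type*} (s : ℕ → α) (k : ℕ) : Set (ℕ → α) :=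
  {w | ∀ i ≤ k, w i = s i}

theorem measurableSet_initialCylinder {α : Type*} [MeasurableSpace α] [MeasurableSingletonClass α]
    (s : ℕ → α) (k : ℕ) : MeasurableSet (initialCylinder s k) := by
  simp only [initialCylinder, Set.ofPred_forall]
  exact .iInter fun i => .iInter fun _ =>
    measurable_pi_apply (X := fun _ : ℕ => α) i (measurableSet_singleton (s i))

/-- Probability measures on the sequences over a finite alphabet are determined by their values on
initial cylinders. -/
theorem measure_ext_initialCylinder {α : Type*} [Finite α] [MeasurableSpace α]
    [DiscreteMeasurableSpace α] {μ ν : Measure (ℕ → α)} [IsProbabilityMeasure μ]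
    [IsProbabilityMeasure ν] (h : ∀ s k, μ (initialCylinder s k) = ν (initialCylinder s k)) :
    μ = ν := by
  refine ext_of_generate_finite _ generateFrom_measurableCylinders.symm
    isPiSystem_measurableCylinders (fun t ht => ?_) (by simp)
  obtain ⟨N, T, mT, rfl⟩ : ∃ N T, MeasurableSet T ∧ t = cylinder (Finset.Iic N) T := by
    simpa [measurableCylinders_nat] using ht
  have key : μ.map (Finset.Iic N).restrict = ν.map (Finset.Iic N).restrict := by
    refine Measure.ext_of_singleton fun x => ?_
    rw [Measure.map_apply (by fun_prop) (measurableSet_singleton x),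
      Measure.map_apply (by fun_prop) (measurableSet_singleton x)]
    -- The values of `w` serve only to continue the prefix `x` beyond time `N`.
    obtain ⟨w⟩ : Nonempty (ℕ → α) := nonempty_of_isProbabilityMeasure μ
    have he : ((Finset.Iic N).restrict : (ℕ → α) → _) ⁻¹' {x} =
        initialCylinder (fun i => if hi : i ∈ Finset.Iic N then x ⟨i, hi⟩ else w i) N := by
      ext v
      simp only [Set.mem_preimage, Set.mem_singleton_iff, funext_iff, initialCylinder,
        Set.mem_ofPred_eq, Subtype.forall, Finset.restrict, Finset.mem_Iic]
      refine forall₂_congr fun i hi => ?_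
      simp [hi]
    rw [he, h]
  rw [cylinder, ← Measure.map_apply (by fun_prop) mT, key, Measure.map_apply (by fun_prop) mT]

/-! ### Transportation cost -/

/-- The easy half of Kantorovich duality: the means of a `d`-nonexpansive function under two
distributions differ by at most their Kantorovich distance. -/
theorem abs_sum_sub_sum_le_kantorovich {X : Type*} [Fintype X] {d : X → X → ℝ} {f : X → ℝ}
    (hf : ∀ x y, |f x - f y| ≤ d x y) (μ ν : stdSimplex ℝ X) :
    |∑ x, μ x * f x - ∑ x, ν x * f x| ≤ kantorovich d μ ν := by
  obtain ⟨ω, ⟨h1, h2⟩, he⟩ := exists_kantorovich_eq d μ ν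
  have hs : ∑ x, μ x * f x - ∑ x, ν x * f x = ∑ x, ∑ y, (f x - f y) * ω (x, y) := by
    simp only [sub_mul, Finset.sum_sub_distrib]
    congr 1
    · simp only [← Finset.mul_sum, h1, mul_comm]
    · rw [Finset.sum_comm]
      simp only [← Finset.mul_sum, h2, mul_comm]
  rw [hs, ← he]
  refine (Finset.abs_sum_le_sum_abs _ _).trans (Finset.sum_le_sum fun x _ =>
    (Finset.abs_sum_le_sum_abs _ _).trans (Finset.sum_le_sum fun y _ => ?_))
  have h0 : 0 ≤ ω (x, y) := ω.2.1 _
  rw [abs_mul, abs_of_nonneg h0]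
  exact mul_le_mul_of_nonneg_right (hf x y) h0

namespace MarkovChain

variable {S : Type*} [Fintype S] {L : Type*} (C : MarkovChain S L)

/-! ### The Markov property of the run -/

section RunMeasure

variable [MeasurableSpace S] [DiscreteMeasurableSpace S]

instance (m : S) : IsProbabilityMeasure (C.runMeasure m) := by
  unfold runMeasure; infer_instance

theorem stepKernel_singleton (s x : S) :
    C.stepKernel s {x} = ENNReal.ofReal (C.trans s x) := by
  classical
  change (∑ y, ENNReal.ofReal (C.trans s y) • Measure.dirac y : Measure S) {x} = _
  simp [Measure.coe_finsetSum, Finset.sum_apply, Set.indicator_apply]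

theorem runMeasure_initialCylinder_zero [DecidableEq S] (m : S) (s : ℕ → S) :
    C.runMeasure m (initialCylinder s 0) = if m = s 0 then 1 else 0 := by
  have he : initialCylinder s 0 =
      (Preorder.frestrictLe 0 : (ℕ → S) → _) ⁻¹' {x | x ⟨0, Finset.mem_Iic.2 le_rfl⟩ = s 0} := by
    ext w; simp [initialCylinder, Preorder.frestrictLe]
  have hm : MeasurableSet {x : Finset.Iic 0 → S | x ⟨0, Finset.mem_Iic.2 le_rfl⟩ = s 0} :=
    measurable_pi_apply (X := fun _ : Finset.Iic 0 => S) _ (measurableSet_singleton (s 0))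
  have hd : (Measure.dirac m).map (MeasurableEquiv.piUnique fun _ : Finset.Iic 0 => S).symm =
      Measure.dirac ((MeasurableEquiv.piUnique fun _ : Finset.Iic 0 => S).symm m) :=
    Measure.map_dirac' (MeasurableEquiv.measurable _) _
  rw [he, ← Measure.map_apply (by fun_prop) hm, runMeasure, Kernel.trajMeasure,
    hd, Measure.dirac_bind (Kernel.measurable _),
    Kernel.traj_map_frestrictLe_apply, Kernel.partialTraj_self, Kernel.id_apply,
    Measure.dirac_apply' _ hm]
  simp only [Set.indicator_apply]
  rfl

theorem runMeasure_initialCylinder_succ (m : S) (s : ℕ → S) (k : ℕ) :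
    C.runMeasure m (initialCylinder s (k + 1)) =
      C.runMeasure m (initialCylinder s k) * ENNReal.ofReal (C.trans (s k) (s (k + 1))) := by
  set T : Set (Finset.Iic k → S) := {x | ∀ i, x i = s i} with hT
  have mT : MeasurableSet T := by measurability
  have h1 : initialCylinder s (k + 1) =
      (fun w : ℕ → S => (Preorder.frestrictLe k w, w (k + 1))) ⁻¹' (T ×ˢ {s (k + 1)}) := by
    ext w
    simp only [initialCylinder, hT, Preorder.frestrictLe, Set.mem_preimage, Set.mem_prod,
      Set.mem_singleton_iff, Set.mem_ofPred_eq, Subtype.forall, Finset.mem_Iic, Finset.restrict]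
    exact ⟨fun h => ⟨fun i hi => h i (by omega), h _ le_rfl⟩, fun h i hi =>
      (Nat.le_succ_iff.1 hi).elim (h.1 i) fun e => e ▸ h.2⟩
  have h2 : initialCylinder s k = (Preorder.frestrictLe k : (ℕ → S) → _) ⁻¹' T := by
    ext w
    simp [initialCylinder, hT, Preorder.frestrictLe]
  rw [h1, h2, ← Measure.map_apply (by fun_prop) (mT.prod (measurableSet_singleton _)),
    ← Measure.map_apply (by fun_prop) mT, runMeasure,
    ← Kernel.map_frestrictLe_trajMeasure_compProd_eq_map_trajMeasure,
    Measure.compProd_apply_prod mT (measurableSet_singleton _), mul_comm,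
    ← setLIntegral_const]
  refine setLIntegral_congr_fun mT fun x hx => ?_
  rw [Kernel.comap_apply, stepKernel_singleton, hx]

/-- Splits off the first step of a prefix, where `runMeasure_initialCylinder_succ` splits off the
last one. -/
theorem runMeasure_initialCylinder_succ' [DecidableEq S] (m : S) (s : ℕ → S) (k : ℕ) :
    C.runMeasure m (initialCylinder s (k + 1)) =
      if m = s 0 then ∑ x, ENNReal.ofReal (C.trans m x) *
        C.runMeasure x (initialCylinder (fun i => s (i + 1)) k) else 0 := by
  induction k with
  | zero =>
    rw [runMeasure_initialCylinder_succ]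
    simp only [runMeasure_initialCylinder_zero]
    split_ifs with h <;> simp [h]
  | succ k ih =>
    rw [runMeasure_initialCylinder_succ, ih]
    simp only [runMeasure_initialCylinder_succ C _ (fun i => s (i + 1))]
    split_ifs <;> simp [Finset.sum_mul, mul_assoc]

/-- The Markov property at time `1`: the run from `m` starts with `m` and continues as a run from
a successor of `m`. Both sides agree on initial cylinders. -/
theorem runMeasure_eq_sum (m : S) :
    C.runMeasure m =
      ∑ x, ENNReal.ofReal (C.trans m x) • (C.runMeasure x).map (seqCons m) := by
  classical
  have hs : ∑ x, ENNReal.ofReal (C.trans m x) = 1 := by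
    rw [← ENNReal.ofReal_sum_of_nonneg fun x _ => stdSimplex.zero_le (C.trans m) x,
      show ∑ x, C.trans m x = 1 from (C.trans m).2.2, ENNReal.ofReal_one]
  have happ (A : Set (ℕ → S)) (hA : MeasurableSet A) :
      (∑ x, ENNReal.ofReal (C.trans m x) • (C.runMeasure x).map (seqCons m)) A =
        ∑ x, ENNReal.ofReal (C.trans m x) * C.runMeasure x (seqCons m ⁻¹' A) := by
    simp [Measure.coe_finsetSum, Measure.map_apply (measurable_seqCons m) hA]
  have : IsProbabilityMeasure
      (∑ x, ENNReal.ofReal (C.trans m x) • (C.runMeasure x).map (seqCons m)) :=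
    ⟨by rw [happ _ .univ]; simp [hs]⟩
  refine measure_ext_initialCylinder fun s k => ?_
  rw [happ _ (measurableSet_initialCylinder s k)]
  -- Prefixes of length one are not covered by the recursion on the first step.
  cases k with
  | zero =>
    rw [runMeasure_initialCylinder_zero]
    have he : seqCons m ⁻¹' initialCylinder s 0 = if m = s 0 then Set.univ else ∅ := by
      ext w
      split_ifs with h <;> simp [initialCylinder, seqCons, h]
    rw [he]
    split_ifs <;> simp [hs]
  | succ k =>
    rw [runMeasure_initialCylinder_succ']
    have he : seqCons m ⁻¹' initialCylinder s (k + 1) =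
        if m = s 0 then initialCylinder (fun i => s (i + 1)) k else ∅ := by
      ext w
      split_ifs with h
      · exact ⟨fun H i hi => H (i + 1) (by omega), fun H i hi => by
          cases i with
          | zero => exact h
          | succ i => exact H i (by omega)⟩
      · exact iff_of_false (fun H => h (H 0 (by omega))) id
    rw [he]
    split_ifs <;> simp

end RunMeasure

/-! ### Probabilities of events of labels -/

section Prob

theorem prob_nonneg (m : S) (A : Set (ℕ → L)) : 0 ≤ C.prob m A := measureReal_nonneg

theorem prob_le_one (m : S) (A : Set (ℕ → L)) : C.prob m A ≤ 1 := by
  let _ : MeasurableSpace S := ⊤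
  exact measureReal_le_one

theorem prob_empty (m : S) : C.prob m ∅ = 0 := by
  simp [prob]

theorem prob_univ (m : S) : C.prob m Set.univ = 1 := by
  let _ : MeasurableSpace S := ⊤
  simp [prob]

variable [MeasurableSpace L]

theorem measurable_label_comp [MeasurableSpace S] [DiscreteMeasurableSpace S] :
    Measurable fun (w : ℕ → S) i => C.label (w i) :=
  measurable_pi_lambda _ fun i => (Measurable.of_discrete (f := C.label)).comp
    (measurable_pi_apply i)

/-- The Markov property for label events: the first label is that of `m`, and the remaining ones are
those of a run from a random successor of `m`. -/
theorem prob_eq_sum (m : S) {A : Set (ℕ → L)} (hA : MeasurableSet A) :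
    C.prob m A = ∑ x, C.trans m x * C.prob x (seqCons (C.label m) ⁻¹' A) := by
  let _ : MeasurableSpace S := ⊤
  have hB := C.measurable_label_comp hA
  unfold prob
  rw [measureReal_def, runMeasure_eq_sum]
  simp only [Measure.coe_finsetSum, Finset.sum_apply, Measure.smul_apply, smul_eq_mul]
  rw [ENNReal.toReal_sum fun x _ => by finiteness]
  refine Finset.sum_congr rfl fun x _ => ?_
  rw [ENNReal.toReal_mul, ENNReal.toReal_ofReal (stdSimplex.zero_le (C.trans m) x),
    ← Set.preimage_ofPred_eq, Set.ofPred_mem_eq, Measure.map_apply (measurable_seqCons m) hB,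
    ← Set.preimage_comp, show (fun (w : ℕ → S) i => C.label (w i)) ∘ seqCons m =
    seqCons (C.label m) ∘ fun w i => C.label (w i) from funext (comp_seqCons C.label m)]
  rfl

/-- The law of the label sequence of a run. -/
noncomputable def labelMeasure (m : S) : Measure (ℕ → L) :=
  letI : MeasurableSpace S := ⊤
  (C.runMeasure m).map fun w i => C.label (w i)

instance (m : S) : IsProbabilityMeasure (C.labelMeasure m) := by
  let _ : MeasurableSpace S := ⊤
  exact Measure.isProbabilityMeasure_map C.measurable_label_comp.aemeasurable

theorem prob_eq_labelMeasure_real (m : S) {A : Set (ℕ → L)} (hA : MeasurableSet A) :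
    C.prob m A = (C.labelMeasure m).real A := by
  let _ : MeasurableSpace S := ⊤
  rw [labelMeasure, map_measureReal_apply C.measurable_label_comp hA]
  rfl

open scoped symmDiff in
/-- A bound on the difference of two run probabilities passes from cylinder events to all
measurable events, since the former are dense for the sum of the two label laws. -/
theorem abs_prob_sub_le_of_measurableCylinders {m n : S} {c : ℝ}
    (h : ∀ A ∈ measurableCylinders fun _ : ℕ => L, |C.prob m A - C.prob n A| ≤ c)
    {A : Set (ℕ → L)} (hA : MeasurableSet A) : |C.prob m A - C.prob n A| ≤ c := by
  refine le_of_forall_pos_le_add fun ε hε => ?_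
  set μ := C.labelMeasure m + C.labelMeasure n
  obtain ⟨B, hB, hBA⟩ := exists_measure_symmDiff_lt_of_generateFrom_isSetRing (μ := μ)
    isSetRing_measurableCylinders
    ⟨{Set.univ}, Set.countable_singleton _,
      Set.singleton_subset_iff.2 (univ_mem_measurableCylinders _), by simp⟩
    generateFrom_measurableCylinders.symm hA (ENNReal.ofReal_pos.2 hε)
  have mB : MeasurableSet B := .of_mem_measurableCylinders hB
  have hm := abs_measureReal_sub_le_measureReal_symmDiff (μ := C.labelMeasure m)
    mB.nullMeasurableSet hA.nullMeasurableSet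
  have hn := abs_measureReal_sub_le_measureReal_symmDiff (μ := C.labelMeasure n)
    mB.nullMeasurableSet hA.nullMeasurableSet
  have hsum : (C.labelMeasure m).real (B ∆ A) + (C.labelMeasure n).real (B ∆ A) < ε := by
    rw [← measureReal_add_apply, measureReal_def]
    exact ENNReal.toReal_lt_of_lt_ofReal hBA
  have hc := h B hB
  rw [prob_eq_labelMeasure_real C _ mB, prob_eq_labelMeasure_real C _ mB] at hc
  rw [prob_eq_labelMeasure_real C _ hA, prob_eq_labelMeasure_real C _ hA]
  rw [abs_le] at *
  constructor <;> linarith [hm.1, hm.2, hn.1, hn.2, hc.1, hc.2]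

end Prob

/-! ### The bound for events depending on finitely many labels -/

open Classical in
/-- The fixed point equation of `bisimDist`. -/
theorem bisimDist_eq_ite (lam : ℝ) (hlam : lam ∈ Set.Ioc (0 : ℝ) 1) (m n : S) :
    C.bisimDist lam hlam m n = if C.label m ≠ C.label n then 1
      else lam * kantorovich (C.bisimDist lam hlam) (C.trans m) (C.trans n) :=
  congrArg (fun d : OneBddPseudometric S => d.toFun m n)
    (C.bisimOperator lam hlam).map_lfp.symm

/-- The distance bound for an event that depends only on the first `k` labels, by induction on `k`
for all pairs of states simultaneously. -/
theorem abs_prob_withSink_sub_le_of_dependsOn {L' : Type*} [MeasurableSpace L']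
    (ι : L ↪ L') (b : L') (lam : ℝ) (hlam : lam ∈ Set.Ioc (0 : ℝ) 1) (k : ℕ)
    {A : Set (ℕ → L')} (hA : MeasurableSet A) (hk : DependsOn (· ∈ A) (Set.Iio k)) (m n : S) :
    |(C.withSink lam hlam ι b).prob (some m) A - (C.withSink lam hlam ι b).prob (some n) A| ≤
      C.bisimDist lam hlam m n := by
  induction k generalizing A m n with
  | zero =>
    have h0 : 0 ≤ C.bisimDist lam hlam m n :=
      (OrderHom.lfp (C.bisimOperator lam hlam)).nonneg m n
    rcases A.eq_empty_or_nonempty with rfl | ⟨v, hv⟩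
    · simpa [prob_empty] using h0
    · have : A = Set.univ := Set.eq_univ_of_forall fun w =>
        (hk (x := v) (y := w) (by simp)).mp hv
      simpa [this, prob_univ] using h0
  | succ k ih =>
    by_cases h : C.label m = C.label n
    · have hl (x : S) : (C.withSink lam hlam ι b).label (some x) = ι (C.label x) := rfl
      set B := seqCons (ι (C.label n)) ⁻¹' A
      have mB : MeasurableSet B := measurable_seqCons _ hA
      have hB : DependsOn (· ∈ B) (Set.Iio k) := fun v w hvw => hk fun i hi => by
        cases i with
        | zero => rfl
        | succ i => exact hvw i (Nat.lt_of_succ_lt_succ hi)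
      -- The sink contributes the same summand for all `x`, and cancels below.
      have hp (x : S) (hx : C.label x = C.label n) : (C.withSink lam hlam ι b).prob (some x) A =
          (1 - lam) * (C.withSink lam hlam ι b).prob none B +
            lam * ∑ y, C.trans x y * (C.withSink lam hlam ι b).prob (some y) B := by
        rw [prob_eq_sum _ _ hA, Fintype.sum_option, Finset.mul_sum, hl, hx]
        simp only [← mul_assoc]
        rfl
      rw [hp m h, hp n rfl, add_sub_add_left_eq_sub, ← mul_sub, abs_mul, abs_of_pos hlam.1,
        bisimDist_eq_ite, if_neg (not_not.2 h)]
      exact mul_le_mul_of_nonneg_left (abs_sum_sub_sum_le_kantorovich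
        (fun x y => ih mB hB x y) _ _) hlam.1.le
    · rw [bisimDist_eq_ite, if_pos h]
      exact abs_sub_le_of_nonneg_of_le (prob_nonneg _ _ _) (prob_le_one _ _ _)
        (prob_nonneg _ _ _) (prob_le_one _ _ _)

end MarkovChain

theorem mainTheorem8 {S : Type*} [Fintype S] {L : Type*} [Countable L] (C : MarkovChain S L)
    {L' : Type*} [Countable L'] [MeasurableSpace L'] [DiscreteMeasurableSpace L']
    (ι : L ↪ L') (b : L') (hb : ∀ m : S, b ≠ ι (C.label m))
    (A : Set (ℕ → L')) (hA : MeasurableSet A)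
    (lam : ℝ) (hlam : lam ∈ Set.Ioc (0 : ℝ) 1) (m n : S) :
    |(C.withSink lam hlam ι b).prob (some m) A - (C.withSink lam hlam ι b).prob (some n) A| ≤
      C.bisimDist lam hlam m n := by
  refine (C.withSink lam hlam ι b).abs_prob_sub_le_of_measurableCylinders (fun B hB => ?_) hA
  have mB : MeasurableSet B := .of_mem_measurableCylinders hB
  obtain ⟨N, T, -, rfl⟩ : ∃ N T, MeasurableSet T ∧ B = cylinder (Finset.Iic N) T := by
    simpa [measurableCylinders_nat] using hB
  refine C.abs_prob_withSink_sub_le_of_dependsOn ι b lam hlam (N + 1) mB (fun v w hvw => ?_) m n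
  have : (Finset.Iic N).restrict v = (Finset.Iic N).restrict w :=
    funext fun i => hvw i (Nat.lt_succ_of_le (Finset.mem_Iic.1 i.2))
  simp only [mem_cylinder, this]
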